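/- Let $G$ be a locally compact Hausdorff groupoid with unit space $G^{(0)}$, range and source maps $r,s\colon G\to G^{(0)}$, and a Haar system $\{\lambda^u\}_{u\in G^{(0)}}$. Let $Z$ be a second countable locally compact Hausdorff space carrying a continuous left action of $G$ whose moment map $r_Z\colon Z\to G^{(0)}$ is continuous and open, and suppose that the action is proper, i.e. that $(g,z)\mapsto(g\cdot z,z)$ is a proper map from $\{(g,z)\in G\times Z: s(g)=r_Z(z)\}$ to $Z\times Z$. Then there is a full equivariant $r_Z$-system on $Z$, that is, a family $\{\nu^u\}_{u\in G^{(0)}}$ of positive Radon measures on $Z$ such that 1. $\operatorname{supp}\nu^u=r_Z^{-1}(u)$ for every $u\in G^{(0)}$; 2. for every $f\in C_c(Z)$ the function $u\mapsto\int_Z f\,d\nu^u$ is continuous on $G^{(0)}$; 3. $g\cdot\nu^{s(g)}=\nu^{r(g)}$ for every $g\in G$, where $(g\cdot\nu^{s(g)})(E)=\nu^{s(g)}(g^{-1}\cdot E)$ for Borel sets $E\subseteq Z$, with $g^{-1}\cdot E=\{z\in Z: r_Z(z)=s(g),\ g\cdot z\in E\}$. Here a Haar system on $G$ is a family $\{\lambda^u\}_{u\in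 G^{(0)}}$ of positive Radon measures on $G$ with the same three properties for $G$ acting on itself by left multiplication (with $r$ in place of $r_Z$). -/

import Mathlib

open MeasureTheory

/-- A topological groupoid with space of arrows `G` and unit space `X`, with range map `r`,
source map `s`, unit inclusion `one`, inversion `inv` and multiplication `mul`.
The product `mul g h` is meaningful exactly when `s g = r h`; the values of `mul` on the other
pairs are unconstrained and are never used.
Since `one` and `r` are continuous and `r ∘ one = id`, the map `one` is a homeomorphism of `X`
onto the subspace of units of `G`. -/
structure TopGroupoid (G X : Type*) [TopologicalSpace G] [TopologicalSpace X] where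
  r : G → X
  s : G → X
  one : X → G
  inv : G → G
  mul : G → G → G
  r_one : ∀ u, r (one u) = u
  s_one : ∀ u, s (one u) = u
  r_mul : ∀ g h, s g = r h → r (mul g h) = r g
  s_mul : ∀ g h, s g = r h → s (mul g h) = s h
  mul_assoc : ∀ g h k, s g = r h → s h = r k → mul (mul g h) k = mul g (mul h k)
  one_mul : ∀ g, mul (one (r g)) g = g
  mul_one : ∀ g, mul g (one (s g)) = g
  r_inv : ∀ g, r (inv g) = s g
  s_inv : ∀ g, s (inv g) = r g
  inv_mul : ∀ g, mul (inv g) g = one (s g)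
  mul_inv : ∀ g, mul g (inv g) = one (r g)
  continuous_r : Continuous r
  continuous_s : Continuous s
  continuous_one : Continuous one
  continuous_inv : Continuous inv
  continuousOn_mul : ContinuousOn (fun p : G × G => mul p.1 p.2) {p | s p.1 = r p.2}

/-- A continuous left action of a topological groupoid on a space `Z`, with moment map `moment`.
The point `act g z` is meaningful exactly when `s g = moment z`; the other values of `act` are
unconstrained and are never used. -/
structure TopGroupoid.LeftAction {G X : Type*} [TopologicalSpace G] [TopologicalSpace X]
    (𝒢 : TopGroupoid G X) (Z : Type*) [TopologicalSpace Z] where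
  moment : Z → X
  act : G → Z → Z
  moment_act : ∀ g z, 𝒢.s g = moment z → moment (act g z) = 𝒢.r g
  one_act : ∀ z, act (𝒢.one (moment z)) z = z
  mul_act : ∀ g h z, 𝒢.s g = 𝒢.r h → 𝒢.s h = moment z →
    act (𝒢.mul g h) z = act g (act h z)
  continuous_moment : Continuous moment
  continuousOn_act :
    ContinuousOn (fun p : G × Z => act p.1 p.2) {p | 𝒢.s p.1 = moment p.2}

/-- The action is proper: the map `(g, z) ↦ (g · z, z)` from the fibred product
`G * Z = {(g, z) | s g = moment z}` to `Z × Z` is a proper map. -/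
def TopGroupoid.LeftAction.IsProper {G X Z : Type*} [TopologicalSpace G] [TopologicalSpace X]
    [TopologicalSpace Z] {𝒢 : TopGroupoid G X} (A : 𝒢.LeftAction Z) : Prop :=
  IsProperMap (fun p : {p : G × Z // 𝒢.s p.1 = A.moment p.2} =>
    ((A.act p.1.1 p.1.2, p.1.2) : Z × Z))

/-- The action of a groupoid on its own space of arrows by left multiplication; the moment map is
the range map. -/
def TopGroupoid.leftMul {G X : Type*} [TopologicalSpace G] [TopologicalSpace X]
    (𝒢 : TopGroupoid G X) : 𝒢.LeftAction G where
  moment := 𝒢.r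
  act := 𝒢.mul
  moment_act := 𝒢.r_mul
  one_act := 𝒢.one_mul
  mul_act := 𝒢.mul_assoc
  continuous_moment := 𝒢.continuous_r
  continuousOn_act := 𝒢.continuousOn_mul

/-- For a map `π : Y → X`, a `π`-system: a family `β` of Radon measures on `Y` indexed by `X`, with
`supp (β x) ⊆ π⁻¹(x)`, such that `x ↦ ∫ f d(β x)` is continuous for every continuous compactly
supported `f`. -/
structure IsSystem {Y X : Type*} [TopologicalSpace Y] [MeasurableSpace Y] [BorelSpace Y]
    [TopologicalSpace X] (π : Y → X) (β : X → Measure Y) : Prop where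
  regular : ∀ x, (β x).Regular
  support_subset : ∀ x, (β x).support ⊆ π ⁻¹' {x}
  continuous_integral : ∀ f : Y → ℝ, Continuous f → HasCompactSupport f →
    Continuous fun x => ∫ y, f y ∂(β x)

/-- A full `π`-system: the support of `β x` is the whole fibre over `x`, for every `x`. -/
structure IsFullSystem {Y X : Type*} [TopologicalSpace Y] [MeasurableSpace Y] [BorelSpace Y]
    [TopologicalSpace X] (π : Y → X) (β : X → Measure Y) : Prop extends IsSystem π β where
  support_eq : ∀ x, (β x).support = π ⁻¹' {x}

/-- Equivariance of a family `β` of measures on a left `G`-space `Z`, indexed by the unit space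
(on which `g` acts by `g · s(g) = r(g)`): `g · β^{s(g)} = β^{r(g)}` for every arrow `g`, where
`(g · β^{s(g)})(E) = β^{s(g)}(g⁻¹ · E)` and
`g⁻¹ · E = {z | moment z = s(g) and g · z ∈ E}`. -/
def TopGroupoid.LeftAction.IsEquivariant {G X Z : Type*} [TopologicalSpace G]
    [TopologicalSpace X] [TopologicalSpace Z] [MeasurableSpace Z] {𝒢 : TopGroupoid G X}
    (A : 𝒢.LeftAction Z) (β : X → Measure Z) : Prop :=
  ∀ g : G, ∀ E : Set Z, MeasurableSet E →
    β (𝒢.s g) {z | A.moment z = 𝒢.s g ∧ A.act g z ∈ E} = β (𝒢.r g) E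

/-- A (continuous, left) Haar system: a full `r`-system on `G` that is equivariant for left
multiplication. -/
def TopGroupoid.IsHaarSystem {G X : Type*} [TopologicalSpace G] [TopologicalSpace X]
    [MeasurableSpace G] [BorelSpace G] (𝒢 : TopGroupoid G X) (lam : X → Measure G) : Prop :=
  IsFullSystem 𝒢.r lam ∧ 𝒢.leftMul.IsEquivariant lam

/-!
The system `ν` is obtained by averaging a full, not yet equivariant system along the orbits.

A continuous family of measures on the fibres of an open map `π : Z → X` is built by hand. For
`q ∈ C_c(Z)` with `q ≥ 0`, the supremum of `q` over the fibre above `u` depends continuously on `u`,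
because `π` is open and `q` has compact support (`continuous_fibreSup`). Starting from a function
`φ`, one multiplies repeatedly by bump functions of smaller and smaller support, which gives a tree
of cells; over each `u`, the mass `fibreSup π φ u` of the root is divided among the children of each
cell in proportion to the fibrewise suprema of their functions. These masses are continuous in `u`,
consistent along the tree, and positive exactly on the cells that meet the fibre. Placing the mass of
each cell at a point of it gives approximations that converge uniformly in `u` on `C_c(Z)`, and the
limit is a continuous family of positive functionals, represented by measures concentrated on
`supp φ ∩ π⁻¹(u)` and charging every open set that meets the part of the fibre where `φ > 0`
(`exists_continuous_fibre_measures`).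

Given such a family `β` on the `G`-space `Z`, properness of the action makes
`g ↦ ∫ f(g · z) dβ^{s(g)}(z)` a function in `C_c(G)` for `f ∈ C_c(Z)`. Its integral against `λ^u` is
continuous in `u`, and left invariance of the Haar system makes the resulting functionals
equivariant. They are positive on `f ≥ 0` as soon as `f(z) > 0` at a point `z` of the fibre with
`φ(z) > 0`, because the unit at `u` is in the support of `λ^u`.

A countable family of such `φ` covers `Z`. The corresponding operators, each bounded on every
`f ∈ C_c(Z)` uniformly in `u`, are summed with weights that force geometric convergence
(`IsPositiveOperator.exists_weights`), so no cutoff function for the action is needed. The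
Riesz–Markov–Kakutani theorem turns the sum into the required system. Translates `z ↦ f(g · z)` live
on a single fibre; whenever a function on all of `Z` is needed they are extended by the Tietze
theorem (`exists_translate`).
-/

open Filter Topology Set

/-! ### Suprema over the fibres of an open map -/

/-- The supremum of `q` over the fibre of `π` above `u`. For `q ≥ 0` bounded this is a genuine
supremum, with value `0` over an empty fibre. -/
noncomputable def fibreSup {Y X : Type*} (π : Y → X) (q : Y → ℝ) (u : X) : ℝ :=
  ⨆ y : π ⁻¹' {u}, q y

section FibreSup

variable {Y X : Type*} {π : Y → X} {q : Y → ℝ}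

lemma fibreSup_nonneg (hq : ∀ y, 0 ≤ q y) (u : X) : 0 ≤ fibreSup π q u :=
  Real.iSup_nonneg fun y => hq y

lemma fibreSup_le {u : X} {c : ℝ} (hc : 0 ≤ c) (h : ∀ y, π y = u → q y ≤ c) :
    fibreSup π q u ≤ c :=
  Real.iSup_le (fun y => h y y.2) hc

lemma le_fibreSup (hb : BddAbove (range q)) (y : Y) : q y ≤ fibreSup π q (π y) :=
  le_ciSup (f := fun y : π ⁻¹' {π y} => q y)
    (hb.mono (by rintro _ ⟨z, rfl⟩; exact mem_range_self _)) ⟨y, rfl⟩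

lemma lt_fibreSup_iff (hb : BddAbove (range q)) {u : X} {c : ℝ} (hc : 0 ≤ c) :
    c < fibreSup π q u ↔ ∃ y, π y = u ∧ c < q y := by
  constructor
  · intro h
    by_contra! hcon
    exact absurd (fibreSup_le hc hcon) (not_le.2 h)
  · rintro ⟨y, rfl, hy⟩
    exact hy.trans_le (le_fibreSup hb y)

/-- Openness of `π` gives lower semicontinuity of the fibrewise supremum, and compactness of the
support of `q` gives upper semicontinuity. -/
lemma continuous_fibreSup [TopologicalSpace Y] [TopologicalSpace X] [T2Space X]
    (hπ : Continuous π) (hopen : IsOpenMap π) (hqc : Continuous q) (hqs : HasCompactSupport q)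
    (hq : ∀ y, 0 ≤ q y) : Continuous (fibreSup π q) := by
  have hb : BddAbove (range q) := hqc.bddAbove_range_of_hasCompactSupport hqs
  refine continuous_iff_continuousAt.2 fun u => tendsto_order.2 ⟨fun c hc => ?_, fun c hc => ?_⟩
  · rcases lt_or_ge c 0 with h0 | h0
    · exact Eventually.of_forall fun v => h0.trans_le (fibreSup_nonneg hq v)
    · obtain ⟨y, rfl, hy⟩ := (lt_fibreSup_iff hb h0).1 hc
      filter_upwards [(hopen _ (isOpen_lt continuous_const hqc)).mem_nhds
        (mem_image_of_mem π (show y ∈ {z | c < q z} from hy))]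
      rintro _ ⟨z, hz, rfl⟩
      exact (lt_fibreSup_iff hb h0).2 ⟨z, rfl, hz⟩
  · obtain ⟨b, hb1, hb2⟩ := exists_between hc
    have hb0 : 0 < b := (fibreSup_nonneg hq u).trans_lt hb1
    have hK : IsCompact {z | b ≤ q z} :=
      hqs.isCompact.of_isClosed_subset (isClosed_le continuous_const hqc)
        fun z hz => subset_tsupport q (Function.mem_support.2 (hb0.trans_le hz).ne')
    have hu : u ∈ (π '' {z | b ≤ q z})ᶜ := by
      rintro ⟨z, hz, rfl⟩
      exact absurd (le_fibreSup hb z) (not_le.2 (hb1.trans_le hz))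
    filter_upwards [(hK.image hπ).isClosed.isOpen_compl.mem_nhds hu] with v hv
    refine (fibreSup_le hb0.le fun z hz => ?_).trans_lt hb2
    by_contra! hcon
    exact hv ⟨z, hcon.le, hz⟩

end FibreSup

/-! ### Refining families of cells -/

/-- A compactly supported function `base` together with, for every `n`, finitely many bump
functions that cover `{base > 0}` and on whose positivity sets every function in `C_c(Z)`
oscillates arbitrarily little as `n` grows. -/
structure BumpTower (Z : Type*) [TopologicalSpace Z] where
  base : Z → ℝ
  continuous_base : Continuous base
  hasCompactSupport_base : HasCompactSupport base
  base_nonneg : ∀ z, 0 ≤ base z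
  base_le_one : ∀ z, base z ≤ 1
  /-- The number of bumps at each level. -/
  N : ℕ → ℕ
  bump : ∀ n, Fin (N n) → Z → ℝ
  continuous_bump : ∀ n i, Continuous (bump n i)
  bump_nonneg : ∀ n i z, 0 ≤ bump n i z
  exists_bump_pos : ∀ n z, 0 < base z → ∃ i, 0 < bump n i z
  small : ∀ f : Z → ℝ, Continuous f → HasCompactSupport f → ∀ ε > 0, ∃ n, ∀ i z z',
    0 < bump n i z → 0 < bump n i z' → |f z - f z'| < ε

/-- Words of length `n` whose `k`-th letter ranges over `Fin (N k)`. -/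
inductive CellIndex (N : ℕ → ℕ) : ℕ → Type
  | nil : CellIndex N 0
  | snoc {n : ℕ} (w : CellIndex N n) (i : Fin (N n)) : CellIndex N (n + 1)

namespace CellIndex

variable {N : ℕ → ℕ}

/-- Splitting off the last letter of a word. -/
def snocEquiv (N : ℕ → ℕ) (n : ℕ) : CellIndex N n × Fin (N n) ≃ CellIndex N (n + 1) where
  toFun p := snoc p.1 p.2
  invFun | snoc w i => (w, i)
  left_inv _ := rfl
  right_inv | snoc _ _ => rfl

instance fintype : ∀ n, Fintype (CellIndex N n)
  | 0 => ⟨{nil}, by rintro ⟨⟩; simp⟩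
  | n + 1 =>
    have := fintype n
    Fintype.ofEquiv _ (snocEquiv N n)

lemma sum_snoc {n : ℕ} (F : CellIndex N (n + 1) → ℝ) :
    ∑ w, F w = ∑ w, ∑ i, F (snoc w i) := by
  rw [← (snocEquiv N n).sum_comp, Fintype.sum_prod_type]
  rfl

end CellIndex

/-- In a locally compact second countable space, metric balls of radius `1 / (n + 1)` provide the
bumps. -/
lemma BumpTower.exists_base_eq {Z : Type*} [TopologicalSpace Z] [T2Space Z]
    [LocallyCompactSpace Z] [SecondCountableTopology Z] {φ : Z → ℝ} (hφ : Continuous φ)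
    (hφs : HasCompactSupport φ) (h0 : ∀ z, 0 ≤ φ z) (h1 : ∀ z, φ z ≤ 1) :
    ∃ T : BumpTower Z, T.base = φ := by
  let := TopologicalSpace.metrizableSpaceMetric Z
  have hcov : ∀ n : ℕ, ∃ t : Finset Z, tsupport φ ⊆ ⋃ x ∈ t, Metric.ball x (1 / (n + 1 : ℝ)) := by
    intro n
    obtain ⟨t, -, ht⟩ := hφs.isCompact.elim_nhds_subcover (fun x => Metric.ball x (1 / (n + 1 : ℝ)))
      fun x _ => Metric.ball_mem_nhds x (by positivity)
    exact ⟨t, ht⟩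
  choose t ht using hcov
  let c : ∀ n, Fin (t n).card → Z := fun n i => ((t n).equivFin.symm i : Z)
  refine ⟨⟨φ, hφ, hφs, h0, h1, fun n => (t n).card,
    fun n i z => max 0 (1 / (n + 1 : ℝ) - dist z (c n i)), fun n i => by fun_prop,
    fun n i z => le_max_left _ _, fun n z hz => ?_, fun f hf hfs ε hε => ?_⟩, rfl⟩
  · obtain ⟨x, hx, hzx⟩ := mem_iUnion₂.1 (ht n (subset_tsupport φ (Function.mem_support.2 hz.ne')))
    refine ⟨(t n).equivFin ⟨x, hx⟩, lt_max_of_lt_right ?_⟩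
    simpa [c] using hzx
  · obtain ⟨δ, hδ, hfδ⟩ := Metric.uniformContinuous_iff.1
      (hfs.uniformContinuous_of_continuous hf) ε hε
    obtain ⟨n, hn⟩ := exists_nat_one_div_lt (half_pos hδ)
    refine ⟨n, fun i z z' hz hz' => ?_⟩
    have hz := (lt_max_iff.1 hz).resolve_left (lt_irrefl _)
    have hz' := (lt_max_iff.1 hz').resolve_left (lt_irrefl _)
    have := dist_triangle_right z z' (c n i)
    exact hfδ (by linarith)

namespace BumpTower

variable {X Z : Type*} [TopologicalSpace Z] (T : BumpTower Z)

/-- The function attached to a word: `base` times the bumps named by its letters. Its positivity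
set is called a cell. -/
noncomputable def cellFun : ∀ n, CellIndex T.N n → Z → ℝ
  | 0, .nil => T.base
  | n + 1, .snoc w i => fun z => cellFun n w z * T.bump n i z

/-- The mass given to a cell over the point `u`: the mass of a cell is divided among its
children in proportion to the suprema of their functions over the fibre above `u`. -/
noncomputable def weight (π : Z → X) : ∀ n, CellIndex T.N n → X → ℝ
  | 0, .nil => fibreSup π T.base
  | n + 1, .snoc w i => fun u => weight π n w u *
      (fibreSup π (T.cellFun (n + 1) (.snoc w i)) u /
        ∑ j, fibreSup π (T.cellFun (n + 1) (.snoc w j)) u)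

lemma cellFun_nonneg : ∀ n (w : CellIndex T.N n) z, 0 ≤ T.cellFun n w z
  | 0, .nil, z => T.base_nonneg z
  | n + 1, .snoc w i, z => mul_nonneg (cellFun_nonneg n w z) (T.bump_nonneg n i z)

lemma continuous_cellFun : ∀ n (w : CellIndex T.N n), Continuous (T.cellFun n w)
  | 0, .nil => T.continuous_base
  | n + 1, .snoc w i => (continuous_cellFun n w).mul (T.continuous_bump n i)

lemma hasCompactSupport_cellFun : ∀ n (w : CellIndex T.N n), HasCompactSupport (T.cellFun n w)
  | 0, .nil => T.hasCompactSupport_base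
  | n + 1, .snoc w _ => (hasCompactSupport_cellFun n w).mul_right

lemma bddAbove_cellFun (n : ℕ) (w : CellIndex T.N n) : BddAbove (range (T.cellFun n w)) :=
  (T.continuous_cellFun n w).bddAbove_range_of_hasCompactSupport (T.hasCompactSupport_cellFun n w)

lemma cellFun_succ_pos_iff {n : ℕ} {w : CellIndex T.N n} {i : Fin (T.N n)} {z : Z} :
    0 < T.cellFun (n + 1) (.snoc w i) z ↔ 0 < T.cellFun n w z ∧ 0 < T.bump n i z := by
  change 0 < T.cellFun n w z * T.bump n i z ↔ _
  have h1 := T.cellFun_nonneg n w z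
  have h2 := T.bump_nonneg n i z
  constructor
  · intro h
    exact ⟨h1.lt_of_ne fun h' => by simp [← h'] at h, h2.lt_of_ne fun h' => by simp [← h'] at h⟩
  · exact fun h => mul_pos h.1 h.2

lemma base_pos_of_cellFun_pos : ∀ {n} {w : CellIndex T.N n} {z : Z}, 0 < T.cellFun n w z →
    0 < T.base z
  | 0, .nil, _, h => h
  | _ + 1, .snoc _ _, _, h => base_pos_of_cellFun_pos (T.cellFun_succ_pos_iff.1 h).1

lemma exists_cellFun_pos {z : Z} (hz : 0 < T.base z) : ∀ n, ∃ w, 0 < T.cellFun n w z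
  | 0 => ⟨.nil, hz⟩
  | n + 1 => by
    obtain ⟨w, hw⟩ := exists_cellFun_pos hz n
    obtain ⟨i, hi⟩ := T.exists_bump_pos n z hz
    exact ⟨.snoc w i, T.cellFun_succ_pos_iff.2 ⟨hw, hi⟩⟩

variable {π : Z → X}

lemma fibreSup_cellFun_pos_iff {n : ℕ} {w : CellIndex T.N n} {u : X} :
    0 < fibreSup π (T.cellFun n w) u ↔ ∃ z, π z = u ∧ 0 < T.cellFun n w z :=
  lt_fibreSup_iff (T.bddAbove_cellFun n w) le_rfl

lemma weight_nonneg : ∀ n (w : CellIndex T.N n) u, 0 ≤ T.weight π n w u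
  | 0, .nil, u => fibreSup_nonneg T.base_nonneg u
  | n + 1, .snoc w _, u => mul_nonneg (weight_nonneg n w u) (div_nonneg
      (fibreSup_nonneg (T.cellFun_nonneg _ _) u)
      (Finset.sum_nonneg fun _ _ => fibreSup_nonneg (T.cellFun_nonneg _ _) u))

lemma sum_fibreSup_pos {n : ℕ} {w : CellIndex T.N n} {u : X}
    (h : ∃ z, π z = u ∧ 0 < T.cellFun n w z) :
    0 < ∑ j, fibreSup π (T.cellFun (n + 1) (.snoc w j)) u := by
  obtain ⟨z, hz, hw⟩ := h
  obtain ⟨i, hi⟩ := T.exists_bump_pos n z (T.base_pos_of_cellFun_pos hw)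
  exact Finset.sum_pos' (fun _ _ => fibreSup_nonneg (T.cellFun_nonneg _ _) u)
    ⟨i, Finset.mem_univ i, T.fibreSup_cellFun_pos_iff.2
      ⟨z, hz, T.cellFun_succ_pos_iff.2 ⟨hw, hi⟩⟩⟩

/-- The mass over `u` sits exactly on the cells that meet the fibre above `u`. -/
lemma weight_pos_iff : ∀ {n} {w : CellIndex T.N n} {u : X},
    0 < T.weight π n w u ↔ ∃ z, π z = u ∧ 0 < T.cellFun n w z
  | 0, .nil, _ => T.fibreSup_cellFun_pos_iff (w := .nil)
  | n + 1, .snoc w i, u => by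
    rw [← T.fibreSup_cellFun_pos_iff]
    change 0 < T.weight π n w u * (_ / _) ↔ _
    constructor
    · intro h
      refine (fibreSup_nonneg (T.cellFun_nonneg _ _) u).lt_of_ne fun h' => ?_
      rw [← h'] at h
      simp at h
    · intro h
      obtain ⟨z, hz, hw⟩ := T.fibreSup_cellFun_pos_iff.1 h
      have hw' : ∃ z, π z = u ∧ 0 < T.cellFun n w z := ⟨z, hz, (T.cellFun_succ_pos_iff.1 hw).1⟩
      exact mul_pos (weight_pos_iff.2 hw') (div_pos h (T.sum_fibreSup_pos hw'))

/-- The masses are consistent along the tree. The exceptional case is a cell missing the fibre, where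
the normalizing sum may be `0` but so is the mass to be divided. -/
lemma sum_weight_succ (n : ℕ) (w : CellIndex T.N n) (u : X) :
    ∑ i, T.weight π (n + 1) (.snoc w i) u = T.weight π n w u := by
  change ∑ i, T.weight π n w u * (fibreSup π (T.cellFun (n + 1) (.snoc w i)) u / _) = _
  rw [← Finset.mul_sum, ← Finset.sum_div]
  rcases (T.weight_nonneg (π := π) n w u).eq_or_lt with h | h
  · rw [← h, zero_mul]
  · rw [div_self (T.sum_fibreSup_pos (T.weight_pos_iff.1 h)).ne', mul_one]

lemma weight_succ_le (n : ℕ) (w : CellIndex T.N n) (i : Fin (T.N n)) (u : X) :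
    T.weight π (n + 1) (.snoc w i) u ≤ T.weight π n w u := by
  rw [← T.sum_weight_succ n w u]
  exact Finset.single_le_sum (f := fun i => T.weight π (n + 1) (.snoc w i) u)
    (fun _ _ => T.weight_nonneg _ _ u) (Finset.mem_univ i)

lemma continuous_weight [TopologicalSpace X] [T2Space X] (hπ : Continuous π)
    (hopen : IsOpenMap π) : ∀ n (w : CellIndex T.N n), Continuous (T.weight π n w)
  | 0, .nil => continuous_fibreSup hπ hopen T.continuous_base T.hasCompactSupport_base T.base_nonneg
  | n + 1, .snoc w i => by
    have hc := continuous_weight hπ hopen n w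
    have hs : ∀ j, Continuous (fibreSup π (T.cellFun (n + 1) (.snoc w j))) := fun j =>
      continuous_fibreSup hπ hopen (T.continuous_cellFun _ _) (T.hasCompactSupport_cellFun _ _)
        (T.cellFun_nonneg _ _)
    refine continuous_iff_continuousAt.2 fun u => ?_
    rcases (T.weight_nonneg (π := π) n w u).eq_or_lt with h | h
    · -- The denominator may vanish here, but the weight is dominated by that of the parent cell.
      have h0 : T.weight π (n + 1) (.snoc w i) u = 0 :=
        le_antisymm ((T.weight_succ_le n w i u).trans h.symm.le) (T.weight_nonneg _ _ u)
      have ht : Tendsto (T.weight π n w) (𝓝 u) (𝓝 0) := by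
        have := hc.tendsto u
        rwa [← h] at this
      rw [ContinuousAt, h0]
      exact squeeze_zero (fun v => T.weight_nonneg _ _ v) (fun v => T.weight_succ_le n w i v) ht
    · exact hc.continuousAt.mul ((hs i).continuousAt.div
        (continuous_finsetSum _ fun j _ => hs j).continuousAt
        (T.sum_fibreSup_pos (T.weight_pos_iff.1 h)).ne')

lemma sum_weight (π : Z → X) (u : X) : ∀ n, ∑ w, T.weight π n w u = fibreSup π T.base u
  | 0 => (Finset.sum_singleton _ _ :
      ∑ w ∈ {CellIndex.nil}, T.weight π 0 w u = T.weight π 0 .nil u)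
  | n + 1 => by
    rw [← sum_weight π u n, CellIndex.sum_snoc]
    exact Finset.sum_congr rfl fun w _ => T.sum_weight_succ n w u

lemma sum_weight_le_one (π : Z → X) (u : X) (n : ℕ) : ∑ w, T.weight π n w u ≤ 1 := by
  rw [T.sum_weight]
  exact fibreSup_le zero_le_one fun z _ => T.base_le_one z

lemma exists_level {f : Z → ℝ} (hf : Continuous f) (hfs : HasCompactSupport f) {ε : ℝ}
    (hε : 0 < ε) : ∃ n, ∀ (w : CellIndex T.N n) z z',
      0 < T.cellFun n w z → 0 < T.cellFun n w z' → |f z - f z'| < ε := by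
  obtain ⟨n, hn⟩ := T.small f hf hfs ε hε
  refine ⟨n + 1, fun w z z' hz hz' => ?_⟩
  cases w with
  | snoc w i => exact hn i z z' (T.cellFun_succ_pos_iff.1 hz).2 (T.cellFun_succ_pos_iff.1 hz').2

variable [Nonempty Z]

/-- A point of each nonempty cell. -/
noncomputable def point (n : ℕ) (w : CellIndex T.N n) : Z :=
  Classical.epsilon fun z => 0 < T.cellFun n w z

lemma cellFun_point_pos {n : ℕ} {w : CellIndex T.N n} (h : ∃ z, 0 < T.cellFun n w z) :
    0 < T.cellFun n w (T.point n w) :=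
  Classical.epsilon_spec h

/-- The integral of `f` over the fibre above `u`, computed at level `n`: the mass of each cell is
placed at a single point of it. -/
noncomputable def approx (π : Z → X) (n : ℕ) (f : Z → ℝ) (u : X) : ℝ :=
  ∑ w, T.weight π n w u * f (T.point n w)

/-- A cellwise upper bound for `f` at level `n` controls all later approximations, because later
cells are contained in earlier ones and the weights are consistent. -/
lemma approx_le {f : Z → ℝ} (u : X) {m : ℕ} : ∀ (k : ℕ) {n : ℕ}, n + k = m →
    ∀ {C : CellIndex T.N n → ℝ},
    (∀ w z, 0 < T.cellFun n w z → f z ≤ C w) → T.approx π m f u ≤ ∑ w, T.weight π n w u * C w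
  | 0, n, hm, C, hC => by
    obtain rfl : n = m := hm
    refine Finset.sum_le_sum fun w _ => ?_
    rcases (T.weight_nonneg (π := π) n w u).eq_or_lt with h | h
    · simp [← h]
    · obtain ⟨z, -, hz⟩ := T.weight_pos_iff.1 h
      exact mul_le_mul_of_nonneg_left (hC w _ (T.cellFun_point_pos ⟨z, hz⟩)) h.le
  | k + 1, n, hm, C, hC => by
    refine (approx_le u k (n := n + 1) (by omega) (C := fun | .snoc w _ => C w) fun
      | .snoc w i, z, hz => hC w z (T.cellFun_succ_pos_iff.1 hz).1).trans_eq ?_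
    rw [CellIndex.sum_snoc]
    refine Finset.sum_congr rfl fun w _ => ?_
    rw [← T.sum_weight_succ n w u, Finset.sum_mul]
    rfl

lemma approx_neg (n : ℕ) (f : Z → ℝ) (u : X) : T.approx π n (-f) u = -T.approx π n f u := by
  simp [approx]

lemma le_approx {f : Z → ℝ} (u : X) {m n : ℕ} (hm : n ≤ m) {C : CellIndex T.N n → ℝ}
    (hC : ∀ w z, 0 < T.cellFun n w z → C w ≤ f z) :
    ∑ w, T.weight π n w u * C w ≤ T.approx π m f u := by
  have := T.approx_le (π := π) (f := -f) u (m - n) (n := n) (m := m) (by omega)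
    (C := fun w => -C w) fun w z hz => neg_le_neg (hC w z hz)
  rw [approx_neg] at this
  simp only [mul_neg, Finset.sum_neg_distrib] at this
  linarith

lemma approx_le_approx_add {f : Z → ℝ} {ε : ℝ} (hε : 0 < ε) {n m : ℕ} (hm : n ≤ m)
    (hn : ∀ (w : CellIndex T.N n) z z', 0 < T.cellFun n w z → 0 < T.cellFun n w z' →
      |f z - f z'| < ε) (u : X) : T.approx π m f u ≤ T.approx π n f u + ε := by
  calc T.approx π m f u ≤ ∑ w, T.weight π n w u * (f (T.point n w) + ε) :=
        T.approx_le u (m - n) (by omega) fun w z hz => by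
          have := (abs_lt.1 (hn w z _ hz (T.cellFun_point_pos ⟨z, hz⟩))).2
          linarith
    _ = T.approx π n f u + (∑ w, T.weight π n w u) * ε := by
        simp only [mul_add, Finset.sum_add_distrib, Finset.sum_mul, approx]
    _ ≤ T.approx π n f u + ε := by
        nlinarith [T.sum_weight_le_one π u n]

lemma exists_abs_approx_sub_le {f : Z → ℝ} (hf : Continuous f) (hfs : HasCompactSupport f)
    {ε : ℝ} (hε : 0 < ε) : ∃ n, ∀ m ≥ n, ∀ u : X, |T.approx π m f u - T.approx π n f u| ≤ ε := by
  obtain ⟨n, hn⟩ := T.exists_level hf hfs hε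
  refine ⟨n, fun m hm u => abs_le.2 ⟨?_, ?_⟩⟩
  · have := T.approx_le_approx_add (π := π) (f := -f) hε hm
      (fun w z z' hz hz' => by
        have := hn w z' z hz' hz
        simpa [neg_add_eq_sub] using this) u
    rw [approx_neg, approx_neg] at this
    linarith
  · linarith [T.approx_le_approx_add (π := π) hε hm hn u]

/-- The limit of the approximations, the integral of `f` over the fibre above `u`. -/
noncomputable def fibreIntegral (π : Z → X) (f : Z → ℝ) (u : X) : ℝ :=
  limUnder atTop fun n => T.approx π n f u

lemma tendsto_fibreIntegral {f : Z → ℝ} (hf : Continuous f) (hfs : HasCompactSupport f) (u : X) :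
    Tendsto (fun n => T.approx π n f u) atTop (𝓝 (T.fibreIntegral π f u)) := by
  refine CauchySeq.tendsto_limUnder (Metric.cauchySeq_iff'.2 fun ε hε => ?_)
  obtain ⟨n, hn⟩ := T.exists_abs_approx_sub_le (π := π) hf hfs (half_pos hε)
  exact ⟨n, fun m hm => by rw [Real.dist_eq]; linarith [hn m hm u]⟩

lemma continuous_fibreIntegral [TopologicalSpace X] [T2Space X] (hπ : Continuous π)
    (hopen : IsOpenMap π) {f : Z → ℝ} (hf : Continuous f) (hfs : HasCompactSupport f) :
    Continuous (T.fibreIntegral π f) := by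
  have hunif : TendstoUniformly (fun n => T.approx π n f) (T.fibreIntegral π f) atTop := by
    refine Metric.tendstoUniformly_iff.2 fun ε hε => ?_
    obtain ⟨n, hn⟩ := T.exists_abs_approx_sub_le (π := π) hf hfs (show 0 < ε / 3 by positivity)
    filter_upwards [eventually_ge_atTop n] with m hm u
    have h1 : |T.fibreIntegral π f u - T.approx π n f u| ≤ ε / 3 :=
      le_of_tendsto ((T.tendsto_fibreIntegral hf hfs u).sub_const _).abs
        ((eventually_ge_atTop n).mono fun k hk => hn k hk u)
    have h2 := hn m hm u
    rw [Real.dist_eq]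
    rw [abs_le] at h1 h2
    rw [abs_lt]
    constructor <;> linarith
  refine hunif.continuous (Frequently.of_forall fun n => ?_)
  exact continuous_finsetSum _ fun w _ => (T.continuous_weight hπ hopen n w).mul continuous_const

lemma fibreIntegral_add {f g : Z → ℝ} (hf : Continuous f) (hfs : HasCompactSupport f)
    (hg : Continuous g) (hgs : HasCompactSupport g) (u : X) :
    T.fibreIntegral π (f + g) u = T.fibreIntegral π f u + T.fibreIntegral π g u := by
  refine tendsto_nhds_unique (T.tendsto_fibreIntegral (hf.add hg) (hfs.add hgs) u)
    (((T.tendsto_fibreIntegral hf hfs u).add (T.tendsto_fibreIntegral hg hgs u)).congr fun n => ?_)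
  simp [approx, mul_add, Finset.sum_add_distrib]

lemma fibreIntegral_smul (c : ℝ) {f : Z → ℝ} (hf : Continuous f) (hfs : HasCompactSupport f)
    (u : X) : T.fibreIntegral π (c • f) u = c * T.fibreIntegral π f u := by
  refine tendsto_nhds_unique (T.tendsto_fibreIntegral (hf.const_smul c) hfs.smul_left u)
    (((T.tendsto_fibreIntegral hf hfs u).const_mul c).congr fun n => ?_)
  simp [approx, Finset.mul_sum, mul_left_comm]

lemma fibreIntegral_nonneg {f : Z → ℝ} (hf : Continuous f) (hfs : HasCompactSupport f)
    (h0 : ∀ z, 0 ≤ f z) (u : X) : 0 ≤ T.fibreIntegral π f u :=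
  ge_of_tendsto' (T.tendsto_fibreIntegral hf hfs u) fun n =>
    Finset.sum_nonneg fun w _ => mul_nonneg (T.weight_nonneg n w u) (h0 _)

lemma fibreIntegral_le_one {f : Z → ℝ} (hf : Continuous f) (hfs : HasCompactSupport f)
    (h1 : ∀ z, f z ≤ 1) (u : X) : T.fibreIntegral π f u ≤ 1 :=
  le_of_tendsto' (T.tendsto_fibreIntegral hf hfs u) fun n =>
    (Finset.sum_le_sum fun w _ => mul_le_of_le_one_right (T.weight_nonneg n w u) (h1 _)).trans
      (T.sum_weight_le_one π u n)

/-- The functional at `u` only sees the part of the fibre above `u` where `base` is positive: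
every cell of positive weight meets that part, and cells are small. -/
lemma fibreIntegral_eq_zero {f : Z → ℝ} (hf : Continuous f) (hfs : HasCompactSupport f) {u : X}
    (h0 : ∀ z, π z = u → 0 < T.base z → f z = 0) : T.fibreIntegral π f u = 0 := by
  refine abs_nonpos_iff.1 (le_of_forall_pos_le_add fun ε hε => ?_)
  obtain ⟨n, hn⟩ := T.exists_level hf hfs (half_pos hε)
  have hb : ∀ m ≥ n, |T.approx π m f u| ≤ ε := by
    intro m hm
    have hup := T.approx_le_approx_add (π := π) (half_pos hε) hm hn u
    have hterm : ∀ w : CellIndex T.N n,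
        |T.weight π n w u * f (T.point n w)| ≤ T.weight π n w u * (ε / 2) := by
      intro w
      rcases (T.weight_nonneg (π := π) n w u).eq_or_lt with h | h
      · simp [← h]
      · obtain ⟨z, hz, hw⟩ := T.weight_pos_iff.1 h
        have := hn w _ z (T.cellFun_point_pos ⟨z, hw⟩) hw
        rw [h0 z hz (T.base_pos_of_cellFun_pos hw), sub_zero] at this
        rw [abs_mul, abs_of_pos h]
        exact mul_le_mul_of_nonneg_left this.le h.le
    have hA : |T.approx π n f u| ≤ ε / 2 := by
      refine (Finset.abs_sum_le_sum_abs _ _).trans ((Finset.sum_le_sum fun w _ => hterm w).trans ?_)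
      rw [← Finset.sum_mul]
      nlinarith [T.sum_weight_le_one π u n]
    have hlow := T.approx_le_approx_add (π := π) (f := -f) (half_pos hε) hm
      (fun w z z' hz hz' => by
        have := hn w z' z hz' hz
        simpa [neg_add_eq_sub] using this) u
    rw [approx_neg, approx_neg] at hlow
    rw [abs_le] at hA ⊢
    constructor <;> linarith
  rw [zero_add]
  exact le_of_tendsto (T.tendsto_fibreIntegral hf hfs u).abs ((eventually_ge_atTop n).mono hb)

/-- A small cell around `z` has positive mass over `π z`, and this mass stays where `f` is bounded
below. -/
lemma fibreIntegral_pos {f : Z → ℝ} (hf : Continuous f) (hfs : HasCompactSupport f)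
    (h0 : ∀ z, 0 ≤ f z) {z : Z} (hfz : 0 < f z) (hz : 0 < T.base z) :
    0 < T.fibreIntegral π f (π z) := by
  classical
  obtain ⟨n, hn⟩ := T.exists_level hf hfs (half_pos hfz)
  obtain ⟨w, hw⟩ := T.exists_cellFun_pos hz n
  have hwt : 0 < T.weight π n w (π z) := T.weight_pos_iff.2 ⟨z, rfl, hw⟩
  have hlow : ∀ m ≥ n, T.weight π n w (π z) * (f z / 2) ≤ T.approx π m f (π z) := by
    intro m hm
    refine le_trans (le_of_eq ?_) (T.le_approx (π := π) (π z) hm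
      (C := fun v => if v = w then f z / 2 else 0) fun v y hy => ?_)
    · simp
    · split_ifs with h
      · subst h
        have := (abs_lt.1 (hn v z y hw hy)).2
        linarith
      · exact h0 y
  exact (mul_pos hwt (half_pos hfz)).trans_le
    (ge_of_tendsto (T.tendsto_fibreIntegral hf hfs _) ((eventually_ge_atTop n).mono hlow))

end BumpTower

/-! ### Measures from positive functionals -/

section Riesz

variable {Z : Type*} [TopologicalSpace Z] [T2Space Z] [LocallyCompactSpace Z]
  [MeasurableSpace Z] [BorelSpace Z]

/-- The Riesz–Markov–Kakutani theorem for a functional given on plain functions. -/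
lemma exists_regular_integral_eq (Λ : (Z → ℝ) → ℝ)
    (hadd : ∀ f g, Continuous f → HasCompactSupport f → Continuous g → HasCompactSupport g →
      Λ (f + g) = Λ f + Λ g)
    (hsmul : ∀ (c : ℝ) f, Continuous f → HasCompactSupport f → Λ (c • f) = c * Λ f)
    (hnonneg : ∀ f, Continuous f → HasCompactSupport f → (∀ z, 0 ≤ f z) → 0 ≤ Λ f) :
    ∃ μ : Measure Z, μ.Regular ∧
      ∀ f, Continuous f → HasCompactSupport f → ∫ z, f z ∂μ = Λ f := by
  let L : CompactlySupportedContinuousMap Z ℝ →ₗ[ℝ] ℝ :=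
    { toFun := fun f => Λ f
      map_add' := fun f g =>
        hadd f g f.continuous f.hasCompactSupport g.continuous g.hasCompactSupport
      map_smul' := fun c f => hsmul c f f.continuous f.hasCompactSupport }
  let P : CompactlySupportedContinuousMap Z ℝ →ₚ[ℝ] ℝ :=
    PositiveLinearMap.mk₀ L fun f hf => hnonneg f f.continuous f.hasCompactSupport hf
  exact ⟨RealRMK.rieszMeasure P, inferInstance, fun f hf hfs =>
    RealRMK.integral_rieszMeasure P ⟨⟨f, hf⟩, hfs⟩⟩

lemma measure_compl_eq_zero_of_integral_eq_zero {μ : Measure Z} [μ.Regular] {S : Set Z}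
    (hS : IsClosed S)
    (h : ∀ f : Z → ℝ, Continuous f → HasCompactSupport f → (∀ z ∈ S, f z = 0) →
      ∫ z, f z ∂μ = 0) : μ Sᶜ = 0 := by
  rw [hS.isOpen_compl.measure_eq_iSup_isCompact]
  simp only [ENNReal.iSup_eq_zero]
  intro K hKS hK
  obtain ⟨f, hf1, hf0, hfs, hf01⟩ := exists_continuous_one_zero_of_isCompact hK hS
    (disjoint_compl_left.mono_left hKS)
  have hint := h f f.continuous hfs hf0
  have hi : Integrable f μ := f.continuous.integrable_of_hasCompactSupport hfs
  have hae := (integral_eq_zero_iff_of_nonneg (fun z => (hf01 z).1) hi).1 hint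
  refine measure_mono_null (fun z hz => ?_) hae
  simp [hf1 hz]

lemma measure_le_one_of_integral_le_one {μ : Measure Z} [μ.Regular]
    (h : ∀ f : Z → ℝ, Continuous f → HasCompactSupport f → (∀ z, f z ≤ 1) →
      ∫ z, f z ∂μ ≤ 1) : μ univ ≤ 1 := by
  rw [isOpen_univ.measure_eq_iSup_isCompact]
  refine iSup₂_le fun K _ => iSup_le fun hK => ?_
  obtain ⟨f, hf1, -, hfs, hf01⟩ := exists_continuous_one_zero_of_isCompact hK isClosed_empty
    (disjoint_empty K)
  have hi : Integrable f μ := f.continuous.integrable_of_hasCompactSupport hfs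
  have h1 : μ K ≤ ENNReal.ofReal (∫ z, f z ∂μ) := by
    rw [ofReal_integral_eq_lintegral_ofReal hi (Eventually.of_forall fun z => (hf01 z).1),
      ← setLIntegral_one K]
    refine (setLIntegral_mono' hK.measurableSet fun z hz => ?_).trans (setLIntegral_le_lintegral K _)
    simp [hf1 hz]
  exact h1.trans (ENNReal.ofReal_le_one.2 (h f f.continuous hfs fun z => (hf01 z).2))

end Riesz

/-! ### Continuous families of measures along an open map -/

/-- An open continuous map `π` carries, for every `φ ∈ C_c(Z)` with `0 ≤ φ ≤ 1`, a continuous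
family of measures of mass at most `1` on its fibres, concentrated on `supp φ` and charging every
open subset of `{φ > 0}` which meets the fibre. -/
theorem exists_continuous_fibre_measures {X Z : Type*} [TopologicalSpace X] [T2Space X]
    [TopologicalSpace Z] [T2Space Z] [LocallyCompactSpace Z] [SecondCountableTopology Z]
    [MeasurableSpace Z] [BorelSpace Z] {π : Z → X} (hπ : Continuous π) (hopen : IsOpenMap π)
    {φ : Z → ℝ} (hφ : Continuous φ) (hφs : HasCompactSupport φ) (h0 : ∀ z, 0 ≤ φ z)
    (h1 : ∀ z, φ z ≤ 1) :
    ∃ β : X → Measure Z, (∀ u, β u univ ≤ 1) ∧ (∀ u, β u (tsupport φ ∩ π ⁻¹' {u})ᶜ = 0) ∧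
      (∀ f : Z → ℝ, Continuous f → HasCompactSupport f → Continuous fun u => ∫ z, f z ∂β u) ∧
      ∀ (f : Z → ℝ) (z : Z), Continuous f → HasCompactSupport f → (∀ z, 0 ≤ f z) → 0 < f z →
        0 < φ z → 0 < ∫ y, f y ∂β (π z) := by
  rcases isEmpty_or_nonempty Z with hZ | hZ
  · exact ⟨fun _ => 0, by simp, by simp, by simp [continuous_const], fun _ z => (hZ.false z).elim⟩
  obtain ⟨T, rfl⟩ := BumpTower.exists_base_eq hφ hφs h0 h1
  have hex : ∀ u, ∃ μ : Measure Z, μ.Regular ∧ ∀ f, Continuous f → HasCompactSupport f →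
      ∫ z, f z ∂μ = T.fibreIntegral π f u := fun u =>
    exists_regular_integral_eq (fun f => T.fibreIntegral π f u)
      (fun f g hf hfs hg hgs => T.fibreIntegral_add hf hfs hg hgs u)
      (fun c f hf hfs => T.fibreIntegral_smul c hf hfs u)
      (fun f hf hfs hf0 => T.fibreIntegral_nonneg hf hfs hf0 u)
  choose β hreg hβ using hex
  refine ⟨β, fun u => ?_, fun u => ?_, fun f hf hfs => ?_, fun f z hf hfs hf0 hfz hz => ?_⟩
  · refine measure_le_one_of_integral_le_one fun f hf hfs hf1 => ?_
    rw [hβ u f hf hfs]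
    exact T.fibreIntegral_le_one hf hfs hf1 u
  · refine measure_compl_eq_zero_of_integral_eq_zero
      ((isClosed_tsupport _).inter (isClosed_singleton.preimage hπ)) fun f hf hfs hfS => ?_
    rw [hβ u f hf hfs]
    exact T.fibreIntegral_eq_zero hf hfs fun z hz hpos =>
      hfS z ⟨subset_tsupport _ (Function.mem_support.2 hpos.ne'), hz⟩
  · exact (T.continuous_fibreIntegral hπ hopen hf hfs).congr fun u => (hβ u f hf hfs).symm
  · rw [hβ _ f hf hfs]
    exact T.fibreIntegral_pos hf hfs hf0 hfz hz

/-! ### Groupoid actions and equivariance -/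

section Action

variable {G X Z : Type*} [TopologicalSpace G] [TopologicalSpace X] [TopologicalSpace Z]
  {𝒢 : TopGroupoid G X}

lemma TopGroupoid.t2Space_units [T2Space G] (𝒢 : TopGroupoid G X) : T2Space X :=
  T2Space.of_injective_continuous (Function.LeftInverse.injective 𝒢.r_one) 𝒢.continuous_one

namespace TopGroupoid.LeftAction

variable (A : 𝒢.LeftAction Z)

lemma act_inv_act {g : G} {z : Z} (h : 𝒢.s g = A.moment z) :
    A.act (𝒢.inv g) (A.act g z) = z := by
  rw [← A.mul_act _ _ _ (𝒢.s_inv g) h, 𝒢.inv_mul, h, A.one_act]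

lemma continuousOn_act_left (g : G) : ContinuousOn (A.act g) {z | A.moment z = 𝒢.s g} :=
  A.continuousOn_act.comp (f := fun z => (g, z)) (by fun_prop) fun _ hz => Eq.symm hz

lemma isClosed_fibre [T1Space X] (u : X) : IsClosed {z | A.moment z = u} :=
  isClosed_singleton.preimage A.continuous_moment

/-- The translate of a compact set by `g⁻¹`, as an image of part of it under the action of
`g⁻¹`. -/
lemma isCompact_translate [T1Space X] (g : G) {K : Set Z} (hK : IsCompact K) :
    IsCompact {z | A.moment z = 𝒢.s g ∧ A.act g z ∈ K} := by
  have hc := A.continuousOn_act_left (𝒢.inv g)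
  rw [𝒢.s_inv] at hc
  have := (hK.inter_right (A.isClosed_fibre (𝒢.r g))).image_of_continuousOn
    (hc.mono inter_subset_right)
  convert! this using 1
  ext z
  constructor
  · rintro ⟨hz, hzK⟩
    exact ⟨A.act g z, ⟨hzK, A.moment_act g z hz.symm⟩, A.act_inv_act hz.symm⟩
  · rintro ⟨w, ⟨hwK, hw⟩, rfl⟩
    have hw' : 𝒢.s (𝒢.inv g) = A.moment w := by rw [𝒢.s_inv]; exact Eq.symm hw
    refine ⟨by rw [A.moment_act _ _ hw', 𝒢.r_inv], ?_⟩
    rw [← A.mul_act _ _ _ (𝒢.r_inv g).symm hw', 𝒢.mul_inv, show 𝒢.r g = A.moment w from Eq.symm hw,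
      A.one_act]
    exact hwK

/-- The translate of `f ∈ C_c(Z)` by an arrow `g` is defined on a single fibre only; by the Tietze
theorem it extends to a function in `C_c(Z)`. -/
lemma exists_translate [T1Space X] [T2Space Z] [LocallyCompactSpace Z]
    [SecondCountableTopology Z] (g : G) {f : Z → ℝ} (hf : Continuous f)
    (hfs : HasCompactSupport f) :
    ∃ f' : Z → ℝ, Continuous f' ∧ HasCompactSupport f' ∧
      ∀ z, A.moment z = 𝒢.s g → f' z = f (A.act g z) := by
  let F : C({z | A.moment z = 𝒢.s g}, ℝ) :=
    ⟨fun z => f (A.act g z), hf.comp (continuousOn_iff_continuous_domRestrict.1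
      (A.continuousOn_act_left g))⟩
  obtain ⟨F', hF'⟩ := ContinuousMap.exists_restrict_eq (A.isClosed_fibre (𝒢.s g)) F
  obtain ⟨χ, hχ1, -, hχs, -⟩ := exists_continuous_one_zero_of_isCompact
    (A.isCompact_translate g hfs.isCompact) isClosed_empty (disjoint_empty _)
  refine ⟨fun z => F' z * χ z, by fun_prop, hχs.mul_left, fun z hz => ?_⟩
  have hFz : F' z = f (A.act g z) := congrArg (fun k : C(_, ℝ) => k ⟨z, hz⟩) hF'
  change F' z * χ z = _
  rw [hFz]
  by_cases h : f (A.act g z) = 0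
  · rw [h, zero_mul]
  · rw [hχ1 ⟨hz, subset_tsupport f h⟩, Pi.one_apply, _root_.mul_one]

variable [T1Space X] [MeasurableSpace Z] [BorelSpace Z]

/-- Equivariance in terms of pushforwards; the restriction discards the points at which the action
of `g` is not meaningful. -/
lemma isEquivariant_iff_map {β : X → Measure Z} : A.IsEquivariant β ↔
    ∀ g, ((β (𝒢.s g)).restrict {z | A.moment z = 𝒢.s g}).map (A.act g) = β (𝒢.r g) := by
  have hS : ∀ u, MeasurableSet {z | A.moment z = u} := fun u => (A.isClosed_fibre u).measurableSet
  have key : ∀ (g : G) (E : Set Z), MeasurableSet E →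
      ((β (𝒢.s g)).restrict {z | A.moment z = 𝒢.s g}).map (A.act g) E =
        β (𝒢.s g) {z | A.moment z = 𝒢.s g ∧ A.act g z ∈ E} := fun g E hE => by
    rw [Measure.map_apply_of_aemeasurable ((A.continuousOn_act_left g).aemeasurable (hS _)) hE,
      Measure.restrict_apply' (hS _), inter_comm]
    rfl
  refine forall_congr' fun g => ⟨fun h => Measure.ext fun E hE => ?_, fun h E hE => ?_⟩
  · rw [key g E hE, h E hE]
  · rw [← key g E hE, h]

variable {A}

/-- Equivariance under the units alone forces concentration on the fibres. -/
lemma IsEquivariant.ae_moment_eq {β : X → Measure Z} (h : A.IsEquivariant β) (u : X) :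
    ∀ᵐ z ∂β u, A.moment z = u := by
  have := h (𝒢.one u) {z | A.moment z = u}ᶜ (A.isClosed_fibre u).isOpen_compl.measurableSet
  rw [𝒢.s_one, 𝒢.r_one] at this
  rw [ae_iff]
  refine this.symm.trans (measure_mono_null (t := ∅) ?_ measure_empty)
  rintro z ⟨rfl, hz⟩
  exact hz (by rw [A.one_act]; rfl)

lemma IsEquivariant.integral_eq {β : X → Measure Z} (h : A.IsEquivariant β) (g : G) {F F' : Z → ℝ}
    (hF : Continuous F) (hF' : ∀ z, A.moment z = 𝒢.s g → F' z = F (A.act g z)) :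
    ∫ z, F z ∂β (𝒢.r g) = ∫ z, F' z ∂β (𝒢.s g) := by
  have hS := (A.isClosed_fibre (𝒢.s g)).measurableSet
  have hr : (β (𝒢.s g)).restrict {z | A.moment z = 𝒢.s g} = β (𝒢.s g) :=
    Measure.restrict_eq_self_of_ae_mem (s := {z | A.moment z = 𝒢.s g}) (h.ae_moment_eq (𝒢.s g))
  rw [← A.isEquivariant_iff_map.1 h g, integral_map
    ((A.continuousOn_act_left g).aemeasurable hS) hF.aestronglyMeasurable, hr]
  refine integral_congr_ae ?_
  filter_upwards [h.ae_moment_eq (𝒢.s g)] with z hz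
  exact (hF' z hz).symm

end TopGroupoid.LeftAction

end Action

lemma MeasureTheory.integral_pos_of_mem_support {Y : Type*} [TopologicalSpace Y]
    [MeasurableSpace Y] {μ : Measure Y} {h : Y → ℝ} (hc : Continuous h) (hi : Integrable h μ)
    (h0 : ∀ y, 0 ≤ h y) {y : Y} (hy : y ∈ μ.support) (hpos : 0 < h y) : 0 < ∫ y, h y ∂μ :=
  (integral_pos_iff_support_of_nonneg h0 hi).2
    ((Measure.mem_support_iff_forall y).1 hy _ (hc.isOpen_support.mem_nhds hpos.ne'))

/-- Integrals over the fibres of a compactly supported function are compactly supported in the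
base. -/
lemma HasCompactSupport.integral_fibre {Y X : Type*} [TopologicalSpace Y] [MeasurableSpace Y]
    [TopologicalSpace X] [T2Space X] {π : Y → X} {β : X → Measure Y}
    (hπ : Continuous π) (hae : ∀ u, ∀ᵐ y ∂β u, π y = u) {h : Y → ℝ} (hs : HasCompactSupport h) :
    HasCompactSupport fun u => ∫ y, h y ∂β u := by
  refine HasCompactSupport.intro (hs.isCompact.image hπ) fun u hu => integral_eq_zero_of_ae ?_
  filter_upwards [hae u] with y hy
  by_contra hne
  exact hu ⟨y, subset_tsupport h hne, hy⟩

/-! ### Averaging over the groupoid -/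

section Average

variable {G X Z : Type*} [TopologicalSpace G] [TopologicalSpace X] [TopologicalSpace Z]
  [MeasurableSpace Z] {𝒢 : TopGroupoid G X} (A : 𝒢.LeftAction Z) (β : X → Measure Z)

/-- The function `g ↦ ∫ f(g · z) dβ^{s(g)}(z)` on the arrows. -/
noncomputable def TopGroupoid.LeftAction.average (f : Z → ℝ) (g : G) : ℝ :=
  ∫ z, f (A.act g z) ∂β (𝒢.s g)

namespace TopGroupoid.LeftAction

variable {A β} {K : Set Z}

lemma average_eq_integral (hβ : ∀ u, β u (K ∩ A.moment ⁻¹' {u})ᶜ = 0) {g : G} {f f' : Z → ℝ}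
    (h : ∀ z, A.moment z = 𝒢.s g → f' z = f (A.act g z)) :
    A.average β f g = ∫ z, f' z ∂β (𝒢.s g) := by
  refine integral_congr_ae ?_
  filter_upwards [mem_ae_iff.2 (hβ (𝒢.s g))] with z hz
  exact (h z hz.2).symm

/-- Averaging intertwines translation of `f` by `g` with left multiplication by `g`. -/
lemma average_mul (hβ : ∀ u, β u (K ∩ A.moment ⁻¹' {u})ᶜ = 0) {g k : G} (hgk : 𝒢.s g = 𝒢.r k)
    {f f' : Z → ℝ} (h : ∀ z, A.moment z = 𝒢.s g → f' z = f (A.act g z)) :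
    A.average β f (𝒢.mul g k) = A.average β f' k := by
  rw [average, average, 𝒢.s_mul g k hgk]
  refine integral_congr_ae ?_
  filter_upwards [mem_ae_iff.2 (hβ (𝒢.s k))] with z hz
  have hz : 𝒢.s k = A.moment z := Eq.symm hz.2
  rw [A.mul_act g k z hgk hz, h _ (by rw [A.moment_act k z hz, hgk])]

lemma average_one (hβ : ∀ u, β u (K ∩ A.moment ⁻¹' {u})ᶜ = 0) (u : X) (f : Z → ℝ) :
    A.average β f (𝒢.one u) = ∫ z, f z ∂β u := by
  have := average_eq_integral (A := A) hβ (g := 𝒢.one u) (f := f) (f' := f) fun z hz => by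
    rw [𝒢.s_one] at hz
    rw [← hz, A.one_act]
  rwa [𝒢.s_one] at this

lemma average_eq_zero (hβ : ∀ u, β u (K ∩ A.moment ⁻¹' {u})ᶜ = 0) {g : G} {f : Z → ℝ}
    (h : ∀ z, A.moment z = 𝒢.r g → f z = 0) : A.average β f g = 0 := by
  refine integral_eq_zero_of_ae ?_
  filter_upwards [mem_ae_iff.2 (hβ (𝒢.s g))] with z hz
  exact h _ (A.moment_act g z (Eq.symm hz.2))

lemma average_nonneg {f : Z → ℝ} (h : ∀ z, 0 ≤ f z) (g : G) : 0 ≤ A.average β f g :=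
  integral_nonneg fun _ => h _

lemma average_smul (c : ℝ) (f : Z → ℝ) (g : G) : A.average β (c • f) g = c * A.average β f g :=
  integral_const_mul c _

variable [T2Space Z] [LocallyCompactSpace Z] [SecondCountableTopology Z] [BorelSpace Z]

lemma average_add [T1Space X] (hβ1 : ∀ u, β u univ ≤ 1)
    (hβ : ∀ u, β u (K ∩ A.moment ⁻¹' {u})ᶜ = 0) {f₁ f₂ : Z → ℝ}
    (hf₁ : Continuous f₁) (hfs₁ : HasCompactSupport f₁) (hf₂ : Continuous f₂)
    (hfs₂ : HasCompactSupport f₂) (g : G) :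
    A.average β (f₁ + f₂) g = A.average β f₁ g + A.average β f₂ g := by
  have : IsFiniteMeasure (β (𝒢.s g)) := ⟨(hβ1 _).trans_lt ENNReal.one_lt_top⟩
  obtain ⟨f₁', hc₁, hs₁, h₁⟩ := A.exists_translate g hf₁ hfs₁
  obtain ⟨f₂', hc₂, hs₂, h₂⟩ := A.exists_translate g hf₂ hfs₂
  rw [average_eq_integral hβ h₁, average_eq_integral hβ h₂,
    average_eq_integral hβ (f' := f₁' + f₂') fun z hz => by simp [h₁ z hz, h₂ z hz]]
  exact integral_add (hc₁.integrable_of_hasCompactSupport hs₁)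
    (hc₂.integrable_of_hasCompactSupport hs₂)

/-- Near an arrow `g₀`, the translate of `f` by `g` is uniformly close on `K` to a fixed function in
`C_c(Z)` extending the translate of `f` by `g₀`. -/
lemma continuous_average [T2Space X] (hK : IsCompact K) (hβ1 : ∀ u, β u univ ≤ 1)
    (hβ : ∀ u, β u (K ∩ A.moment ⁻¹' {u})ᶜ = 0)
    (hβc : ∀ f : Z → ℝ, Continuous f → HasCompactSupport f → Continuous fun u => ∫ z, f z ∂β u)
    {f : Z → ℝ} (hf : Continuous f) (hfs : HasCompactSupport f) :
    Continuous (A.average β f) := by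
  refine continuous_iff_continuousAt.2 fun g₀ => Metric.tendsto_nhds.2 fun ε hε => ?_
  obtain ⟨f₀, hc₀, hs₀, h₀⟩ := A.exists_translate g₀ hf hfs
  have hclose : ∀ᶠ g in 𝓝 g₀, ∀ z ∈ K, A.moment z = 𝒢.s g →
      |f (A.act g z) - f₀ z| ≤ ε / 2 := by
    refine hK.eventually_forall_of_forall_eventually fun z _ => ?_
    by_cases hz : A.moment z = 𝒢.s g₀
    · have hact := A.continuousOn_act (g₀, z) hz.symm
      have ht : Tendsto (fun p : G × Z => |f (A.act p.1 p.2) - f₀ p.2|)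
          (𝓝[{p | 𝒢.s p.1 = A.moment p.2}] (g₀, z)) (𝓝 0) := by
        have := ((hf.continuousAt.comp_continuousWithinAt hact).sub
          (hc₀.comp continuous_snd).continuousWithinAt).abs
        simpa [ContinuousWithinAt, h₀ z hz] using this
      have := eventually_nhdsWithin_iff.1 (ht.eventually_le_const (half_pos hε))
      exact this.mono fun p hp hpz => hp hpz.symm
    · have ho : IsOpen {p : G × Z | A.moment p.2 ≠ 𝒢.s p.1} :=
        isOpen_ne_fun (A.continuous_moment.comp continuous_snd)
          (𝒢.continuous_s.comp continuous_fst)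
      have := ho.mem_nhds (show (g₀, z) ∈ {p : G × Z | A.moment p.2 ≠ 𝒢.s p.1} from hz)
      filter_upwards [this] with p hp hpz using (hp hpz).elim
  have hlim : ∀ᶠ g in 𝓝 g₀, dist (∫ z, f₀ z ∂β (𝒢.s g)) (∫ z, f₀ z ∂β (𝒢.s g₀)) < ε / 2 :=
    Metric.tendsto_nhds.1 ((hβc f₀ hc₀ hs₀).comp 𝒢.continuous_s).continuousAt _ (half_pos hε)
  filter_upwards [hclose, hlim] with g hg hg'
  have : IsFiniteMeasure (β (𝒢.s g)) := ⟨(hβ1 _).trans_lt ENNReal.one_lt_top⟩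
  obtain ⟨f₁, hc₁, hs₁, h₁⟩ := A.exists_translate g hf hfs
  rw [average_eq_integral hβ h₀, average_eq_integral hβ h₁]
  have hdiff : dist (∫ z, f₁ z ∂β (𝒢.s g)) (∫ z, f₀ z ∂β (𝒢.s g)) ≤ ε / 2 := by
    rw [dist_eq_norm, ← integral_sub (hc₁.integrable_of_hasCompactSupport hs₁)
      (hc₀.integrable_of_hasCompactSupport hs₀)]
    refine (norm_integral_le_of_norm_le_const (C := ε / 2) ?_).trans ?_
    · filter_upwards [mem_ae_iff.2 (hβ (𝒢.s g))] with z hz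
      rw [h₁ z hz.2]
      exact hg z hz.1 hz.2
    · have : (β (𝒢.s g)).real univ ≤ 1 := ENNReal.toReal_le_of_le_ofReal zero_le_one
        (by simpa using hβ1 (𝒢.s g))
      exact mul_le_of_le_one_right (half_pos hε).le this
  calc _ ≤ _ := dist_triangle _ (∫ z, f₀ z ∂β (𝒢.s g)) _
    _ < ε := by linarith

omit [LocallyCompactSpace Z] [SecondCountableTopology Z] [BorelSpace Z] [T2Space Z] in
/-- This is where properness of the action enters. -/
lemma hasCompactSupport_average [T2Space G] (hproper : A.IsProper) (hK : IsCompact K)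
    (hβ : ∀ u, β u (K ∩ A.moment ⁻¹' {u})ᶜ = 0) {f : Z → ℝ} (hfs : HasCompactSupport f) :
    HasCompactSupport (A.average β f) := by
  have hC := (hproper.isCompact_preimage (hfs.isCompact.prod hK)).image
    (continuous_fst.comp continuous_subtype_val)
  refine HasCompactSupport.intro hC fun g hg => integral_eq_zero_of_ae ?_
  filter_upwards [mem_ae_iff.2 (hβ (𝒢.s g))] with z hz
  by_contra hne
  exact hg ⟨⟨(g, z), Eq.symm hz.2⟩, ⟨subset_tsupport f hne, hz.1⟩, rfl⟩

end TopGroupoid.LeftAction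

end Average

/-! ### Summing countably many families of positive functionals -/

/-- A positive linear operator from `C_c(Z)` to the bounded continuous functions on `X`, given on
plain functions. -/
structure IsPositiveOperator {Z X : Type*} [TopologicalSpace Z] [TopologicalSpace X]
    (I : (Z → ℝ) → X → ℝ) : Prop where
  add : ∀ f g, Continuous f → HasCompactSupport f → Continuous g → HasCompactSupport g →
    ∀ u, I (f + g) u = I f u + I g u
  smul : ∀ (c : ℝ) f, Continuous f → HasCompactSupport f → ∀ u, I (c • f) u = c * I f u
  nonneg : ∀ f, Continuous f → HasCompactSupport f → (∀ z, 0 ≤ f z) → ∀ u, 0 ≤ I f u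
  continuous : ∀ f, Continuous f → HasCompactSupport f → Continuous (I f)
  bounded : ∀ f, Continuous f → HasCompactSupport f → ∃ B, ∀ u, |I f u| ≤ B

namespace IsPositiveOperator

variable {Z X : Type*} [TopologicalSpace Z] [TopologicalSpace X]

lemma abs_apply_le {I : (Z → ℝ) → X → ℝ} (hI : IsPositiveOperator I) {f φ : Z → ℝ}
    (hf : Continuous f) (hfs : HasCompactSupport f) (hφ : Continuous φ) (hφs : HasCompactSupport φ) {C : ℝ}
    (h : ∀ z, |f z| ≤ C * φ z) (u : X) : |I f u| ≤ C * I φ u := by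
  have h1 := hI.nonneg (C • φ + f) ((hφ.const_smul C).add hf) (hφs.smul_left.add hfs)
    (fun z => by have := (abs_le.1 (h z)).1; simp; linarith) u
  have h2 := hI.nonneg (C • φ + (-1 : ℝ) • f) ((hφ.const_smul C).add (hf.const_smul _))
    (hφs.smul_left.add hfs.smul_left)
    (fun z => by have := (abs_le.1 (h z)).2; simp; linarith) u
  rw [hI.add _ _ (hφ.const_smul C) hφs.smul_left hf hfs, hI.smul C φ hφ hφs] at h1
  rw [hI.add _ _ (hφ.const_smul C) hφs.smul_left (hf.const_smul _) hfs.smul_left,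
    hI.smul C φ hφ hφs, hI.smul _ f hf hfs] at h2
  exact abs_le.2 ⟨by linarith, by linarith⟩

/-- Given a sequence `φ` that eventually dominates every function in `C_c(Z)` up to a constant, the
operators can be scaled so that their sum converges geometrically on `C_c(Z)`: it suffices that
the `m`-th one be at most `2⁻ᵐ` on `φ 0, …, φ m`. -/
lemma exists_weights {I : ℕ → (Z → ℝ) → X → ℝ} (hI : ∀ m, IsPositiveOperator (I m))
    {φ : ℕ → Z → ℝ} (hφ : ∀ j, Continuous (φ j)) (hφs : ∀ j, HasCompactSupport (φ j))
    (hdom : ∀ f : Z → ℝ, Continuous f → HasCompactSupport f →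
      ∃ j C, 0 ≤ C ∧ ∀ z, |f z| ≤ C * φ j z) :
    ∃ c : ℕ → ℝ, (∀ m, 0 < c m) ∧ ∀ f : Z → ℝ, Continuous f → HasCompactSupport f →
      ∃ D, ∀ m u, |c m * I m f u| ≤ D * (1 / 2) ^ m := by
  choose B hB using fun m j => (hI m).bounded (φ j) (hφ j) (hφs j)
  let S : ℕ → ℝ := fun m => ∑ j ∈ Finset.range (m + 1), |B m j|
  have hS : ∀ m, 0 ≤ S m := fun m => Finset.sum_nonneg fun _ _ => abs_nonneg _
  let c : ℕ → ℝ := fun m => (1 / 2) ^ m / (1 + S m)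
  have hc : ∀ m, 0 < c m := fun m => div_pos (by positivity) (by linarith [hS m])
  refine ⟨c, hc, fun f hf hfs => ?_⟩
  obtain ⟨j, C, hC, hfC⟩ := hdom f hf hfs
  choose B' hB' using fun m => (hI m).bounded f hf hfs
  refine ⟨C + ∑ m ∈ Finset.range j, |2 ^ m * c m * B' m|, fun m u => ?_⟩
  rw [abs_mul, abs_of_pos (hc m)]
  have hsum : 0 ≤ ∑ m ∈ Finset.range j, |2 ^ m * c m * B' m| :=
    Finset.sum_nonneg fun _ _ => abs_nonneg _
  have h2 : (2 : ℝ) ^ m * (1 / 2) ^ m = 1 := by rw [← mul_pow]; norm_num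
  have hp : (0 : ℝ) < (1 / 2) ^ m := by positivity
  rcases lt_or_ge m j with hm | hm
  · have hle : 2 ^ m * c m * B' m ≤ ∑ m ∈ Finset.range j, |2 ^ m * c m * B' m| :=
      (le_abs_self _).trans (Finset.single_le_sum (f := fun m => |2 ^ m * c m * B' m|)
        (fun _ _ => abs_nonneg _) (Finset.mem_range.2 hm))
    calc c m * |I m f u| ≤ c m * B' m := mul_le_mul_of_nonneg_left (hB' m u) (hc m).le
      _ = (2 ^ m * c m * B' m) * (1 / 2) ^ m := by linear_combination (-(c m * B' m)) * h2
      _ ≤ _ := mul_le_mul_of_nonneg_right (by linarith) hp.le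
  · have hIj : I m (φ j) u ≤ S m :=
      ((le_abs_self _).trans (hB m j u)).trans ((le_abs_self _).trans
        (Finset.single_le_sum (f := fun j => |B m j|) (fun _ _ => abs_nonneg _)
          (Finset.mem_range.2 (by omega))))
    have hcS : c m * S m ≤ (1 / 2) ^ m := by
      rw [div_mul_eq_mul_div, div_le_iff₀ (by linarith [hS m])]
      exact mul_le_mul_of_nonneg_left (by linarith) hp.le
    calc c m * |I m f u| ≤ c m * (C * S m) :=
          mul_le_mul_of_nonneg_left (((hI m).abs_apply_le hf hfs (hφ j) (hφs j) hfC u).trans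
            (mul_le_mul_of_nonneg_left hIj hC)) (hc m).le
      _ = C * (c m * S m) := by ring
      _ ≤ C * (1 / 2) ^ m := mul_le_mul_of_nonneg_left hcS hC
      _ ≤ _ := mul_le_mul_of_nonneg_right (by linarith) hp.le

lemma tsum {I : ℕ → (Z → ℝ) → X → ℝ} (hI : ∀ m, IsPositiveOperator (I m)) {c : ℕ → ℝ}
    (hc : ∀ m, 0 < c m) (hD : ∀ f : Z → ℝ, Continuous f → HasCompactSupport f →
      ∃ D, ∀ m u, |c m * I m f u| ≤ D * (1 / 2) ^ m) :
    IsPositiveOperator fun f u => ∑' m, c m * I m f u := by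
  have hgeom : ∀ D : ℝ, Summable fun m : ℕ => D * (1 / 2) ^ m := fun D =>
    summable_geometric_two.mul_left D
  have hsum : ∀ f : Z → ℝ, Continuous f → HasCompactSupport f → ∀ u,
      Summable fun m => c m * I m f u := fun f hf hfs u => by
    obtain ⟨D, hD⟩ := hD f hf hfs
    exact Summable.of_norm_bounded (hgeom D) fun m => hD m u
  refine ⟨fun f g hf hfs hg hgs u => ?_, fun a f hf hfs u => ?_, fun f hf hfs h0 u => ?_,
    fun f hf hfs => ?_, fun f hf hfs => ?_⟩
  · rw [← (hsum f hf hfs u).tsum_add (hsum g hg hgs u)]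
    exact tsum_congr fun m => by rw [(hI m).add f g hf hfs hg hgs, mul_add]
  · rw [← tsum_mul_left]
    exact tsum_congr fun m => by rw [(hI m).smul a f hf hfs, mul_left_comm]
  · exact tsum_nonneg fun m => mul_nonneg (hc m).le ((hI m).nonneg f hf hfs h0 u)
  · obtain ⟨D, hD⟩ := hD f hf hfs
    exact continuous_tsum (fun m => ((hI m).continuous f hf hfs).const_mul (c m)) (hgeom D) hD
  · obtain ⟨D, hD⟩ := hD f hf hfs
    exact ⟨∑' m : ℕ, D * (1 / 2) ^ m, fun u => (Real.norm_eq_abs _).symm.trans_le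
      (tsum_of_norm_bounded (hgeom D).hasSum fun m => hD m u)⟩

lemma tsum_pos {I : ℕ → (Z → ℝ) → X → ℝ} (hI : ∀ m, IsPositiveOperator (I m)) {c : ℕ → ℝ}
    (hc : ∀ m, 0 < c m) (hD : ∀ f : Z → ℝ, Continuous f → HasCompactSupport f →
      ∃ D, ∀ m u, |c m * I m f u| ≤ D * (1 / 2) ^ m) {f : Z → ℝ} (hf : Continuous f)
    (hfs : HasCompactSupport f) (h0 : ∀ z, 0 ≤ f z) {u : X} {m : ℕ} (hm : 0 < I m f u) :
    0 < ∑' m, c m * I m f u := by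
  obtain ⟨D, hD⟩ := hD f hf hfs
  exact (Summable.of_norm_bounded (summable_geometric_two.mul_left D) fun m => hD m u).tsum_pos
    (fun m => mul_nonneg (hc m).le ((hI m).nonneg f hf hfs h0 u)) m (mul_pos (hc m) hm)

end IsPositiveOperator

/-- A locally compact second countable space carries a sequence in `C_c(Z)` with values in `[0, 1]`
that eventually equals `1` on every compact set. -/
lemma exists_dominating_sequence (Z : Type*) [TopologicalSpace Z] [T2Space Z]
    [LocallyCompactSpace Z] [SecondCountableTopology Z] :
    ∃ φ : ℕ → Z → ℝ, (∀ j, Continuous (φ j)) ∧ (∀ j, HasCompactSupport (φ j)) ∧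
      (∀ j z, 0 ≤ φ j z) ∧ (∀ j z, φ j z ≤ 1) ∧ (∀ z, ∃ j, 0 < φ j z) ∧
      ∀ f : Z → ℝ, Continuous f → HasCompactSupport f →
        ∃ j C, 0 ≤ C ∧ ∀ z, |f z| ≤ C * φ j z := by
  let K : CompactExhaustion Z := default
  choose φ h1 _ hs h01 using fun j => exists_continuous_one_zero_of_isCompact (K.isCompact j)
    isClosed_empty (disjoint_empty _)
  refine ⟨fun j => φ j, fun j => (φ j).continuous, hs, fun j z => (h01 j z).1,
    fun j z => (h01 j z).2, fun z => ?_, fun f hf hfs => ?_⟩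
  · obtain ⟨j, hj⟩ := K.exists_mem z
    exact ⟨j, one_pos.trans_eq (h1 j hj).symm⟩
  · obtain ⟨j, hj⟩ := K.exists_superset_of_isCompact hfs.isCompact
    obtain ⟨C, hC⟩ := hfs.exists_bound_of_continuous hf
    refine ⟨j, |C|, abs_nonneg C, fun z => ?_⟩
    by_cases hz : z ∈ tsupport f
    · change |f z| ≤ |C| * φ j z
      rw [h1 j (hj hz), Pi.one_apply, mul_one]
      exact (hC z).trans (le_abs_self C)
    · rw [image_eq_zero_of_notMem_tsupport hz, abs_zero]
      exact mul_nonneg (abs_nonneg C) (h01 j z).1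

/-! ### Equivariant systems from equivariant functionals -/

namespace TopGroupoid

variable {G X Z : Type*} [TopologicalSpace G] [TopologicalSpace X] [TopologicalSpace Z]
  [MeasurableSpace Z] [BorelSpace Z] {𝒢 : TopGroupoid G X}

lemma isPositiveOperator_integral_average [T2Space G] [MeasurableSpace G]
    [BorelSpace G] [T2Space Z] [LocallyCompactSpace Z] [SecondCountableTopology Z]
    {lam : X → Measure G} (hlam : 𝒢.IsHaarSystem lam) {A : 𝒢.LeftAction Z}
    (hproper : A.IsProper) {K : Set Z} (hK : IsCompact K) {β : X → Measure Z}
    (hβ1 : ∀ u, β u univ ≤ 1) (hβ : ∀ u, β u (K ∩ A.moment ⁻¹' {u})ᶜ = 0)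
    (hβc : ∀ f : Z → ℝ, Continuous f → HasCompactSupport f →
      Continuous fun u => ∫ z, f z ∂β u) :
    IsPositiveOperator fun (f : Z → ℝ) u => ∫ k, A.average β f k ∂lam u := by
  have := 𝒢.t2Space_units
  have hreg := hlam.1.regular
  have hac : ∀ f : Z → ℝ, Continuous f → HasCompactSupport f → Continuous (A.average β f) :=
    fun f hf hfs => A.continuous_average hK hβ1 hβ hβc hf hfs
  have has : ∀ f : Z → ℝ, HasCompactSupport f → HasCompactSupport (A.average β f) :=
    fun f hfs => A.hasCompactSupport_average hproper hK hβ hfs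
  have hcont : ∀ f : Z → ℝ, Continuous f → HasCompactSupport f →
      Continuous fun u => ∫ k, A.average β f k ∂lam u := fun f hf hfs =>
    hlam.1.continuous_integral _ (hac f hf hfs) (has f hfs)
  refine ⟨fun f g hf hfs hg hgs u => ?_, fun c f _ _ u => ?_, fun f _ _ h0 u => ?_, hcont,
    fun f hf hfs => ?_⟩
  · rw [← integral_add ((hac f hf hfs).integrable_of_hasCompactSupport (has f hfs))
      ((hac g hg hgs).integrable_of_hasCompactSupport (has g hgs))]
    exact integral_congr_ae (Eventually.of_forall fun k =>
      A.average_add hβ1 hβ hf hfs hg hgs k)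
  · rw [← integral_const_mul]
    exact integral_congr_ae (Eventually.of_forall fun k => A.average_smul c f k)
  · exact integral_nonneg fun k => A.average_nonneg h0 k
  · have hcs := HasCompactSupport.integral_fibre 𝒢.continuous_r
      (hlam.2.ae_moment_eq (A := 𝒢.leftMul)) (has f hfs)
    exact hcs.exists_bound_of_continuous (hcont f hf hfs)

/-- A positive operator on `C_c(Z)` which is local on the fibres, faithful on them, and invariant
under translation by arrows is represented by a full equivariant system. -/
theorem LeftAction.exists_isFullSystem_of_isPositiveOperator [T1Space X] [T2Space Z]
    [LocallyCompactSpace Z] [SecondCountableTopology Z] (A : 𝒢.LeftAction Z) {I : (Z → ℝ) → X → ℝ}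
    (hI : IsPositiveOperator I)
    (hlocal : ∀ f u, Continuous f → HasCompactSupport f → (∀ z, A.moment z = u → f z = 0) →
      I f u = 0)
    (hpos : ∀ f z, Continuous f → HasCompactSupport f → (∀ z, 0 ≤ f z) → 0 < f z →
      0 < I f (A.moment z))
    (hinv : ∀ g f f', Continuous f → HasCompactSupport f → Continuous f' → HasCompactSupport f' →
      (∀ z, A.moment z = 𝒢.s g → f' z = f (A.act g z)) → I f (𝒢.r g) = I f' (𝒢.s g)) :
    ∃ ν : X → Measure Z, IsFullSystem A.moment ν ∧ A.IsEquivariant ν := by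
  choose ν hreg hν using fun u => exists_regular_integral_eq (fun f => I f u)
    (fun f g hf hfs hg hgs => hI.add f g hf hfs hg hgs u) (fun c f hf hfs => hI.smul c f hf hfs u)
    (fun f hf hfs h0 => hI.nonneg f hf hfs h0 u)
  have hfib : ∀ u, ν u (A.moment ⁻¹' {u})ᶜ = 0 := fun u =>
    measure_compl_eq_zero_of_integral_eq_zero (A.isClosed_fibre u) fun f hf hfs hf0 => by
      rw [hν u f hf hfs, hlocal f u hf hfs hf0]
  have hsub : ∀ u, (ν u).support ⊆ A.moment ⁻¹' {u} := fun u =>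
    Measure.support_subset_of_isClosed (A.isClosed_fibre u) (mem_ae_iff.2 (hfib u))
  refine ⟨ν, ⟨⟨hreg, hsub, fun f hf hfs => ?_⟩, fun u => (hsub u).antisymm ?_⟩, ?_⟩
  · exact (hI.continuous f hf hfs).congr fun u => (hν u f hf hfs).symm
  · rintro z rfl
    refine (Measure.mem_support_iff_forall z).2 fun U hU => pos_iff_ne_zero.2 fun h0 => ?_
    obtain ⟨f, hf1, hf0, hfs, hf01⟩ := exists_continuous_one_zero_of_isCompact
      (isCompact_singleton (x := z)) isOpen_interior.isClosed_compl
      (disjoint_compl_right_iff_subset.2 (singleton_subset_iff.2 (mem_interior_iff_mem_nhds.2 hU)))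
    have hp := hpos f z f.continuous hfs (fun z => (hf01 z).1)
      (by rw [hf1 (mem_singleton z)]; exact one_pos)
    rw [← hν _ f f.continuous hfs] at hp
    refine hp.ne' (integral_eq_zero_of_ae ?_)
    filter_upwards [mem_ae_iff.2 (show ν (A.moment z) Uᶜᶜ = 0 by rwa [compl_compl])] with y hy
    exact hf0 fun hy' => hy (interior_subset hy')
  · refine A.isEquivariant_iff_map.2 fun g => ?_
    have hS := (A.isClosed_fibre (𝒢.s g)).measurableSet
    have hact := (A.continuousOn_act_left g).aemeasurable (μ := ν (𝒢.s g)) hS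
    let := TopologicalSpace.metrizableSpaceMetric Z
    have hfin : IsFiniteMeasureOnCompacts
        (((ν (𝒢.s g)).restrict {z | A.moment z = 𝒢.s g}).map (A.act g)) := ⟨fun K hK => by
      rw [Measure.map_apply_of_aemeasurable hact hK.measurableSet, Measure.restrict_apply' hS,
        inter_comm]
      exact (A.isCompact_translate g hK).measure_lt_top⟩
    have hr : (ν (𝒢.s g)).restrict {z | A.moment z = 𝒢.s g} = ν (𝒢.s g) :=
      Measure.restrict_eq_self_of_ae_mem (s := {z | A.moment z = 𝒢.s g})
        (mem_ae_iff.2 (hfib (𝒢.s g)))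
    refine Measure.ext_of_integral_eq_on_compactlySupported fun f => ?_
    have hf : Continuous ⇑f := map_continuous f
    have hfs : HasCompactSupport ⇑f := f.hasCompactSupport
    obtain ⟨f', hf', hfs', hff'⟩ := A.exists_translate g hf hfs
    rw [integral_map hact hf.aestronglyMeasurable, hν _ f hf hfs,
      hinv g f f' hf hfs hf' hfs' hff', ← hν _ f' hf' hfs', hr]
    refine integral_congr_ae ?_
    filter_upwards [mem_ae_iff.2 (hfib (𝒢.s g))] with z hz
    exact (hff' z hz).symm

end TopGroupoid

theorem proposition2 {G X Z : Type*}
    [TopologicalSpace G] [T2Space G] [LocallyCompactSpace G] [MeasurableSpace G] [BorelSpace G]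
    [TopologicalSpace X]
    (𝒢 : TopGroupoid G X)
    (lam : X → Measure G) (hlam : 𝒢.IsHaarSystem lam)
    [TopologicalSpace Z] [T2Space Z] [LocallyCompactSpace Z] [SecondCountableTopology Z]
    [MeasurableSpace Z] [BorelSpace Z]
    (A : 𝒢.LeftAction Z) (hopen : IsOpenMap A.moment) (hproper : A.IsProper) :
    ∃ ν : X → Measure Z, IsFullSystem A.moment ν ∧ A.IsEquivariant ν := by
  have := 𝒢.t2Space_units
  have hreg := hlam.1.regular
  obtain ⟨φ, hφ, hφs, h0, h1, hcov, hdom⟩ := exists_dominating_sequence Z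
  choose β hβ1 hβ hβc hβpos using fun m => exists_continuous_fibre_measures A.continuous_moment
    hopen (hφ m) (hφs m) (h0 m) (h1 m)
  let I : ℕ → (Z → ℝ) → X → ℝ := fun m f u => ∫ k, A.average (β m) f k ∂lam u
  have hI : ∀ m, IsPositiveOperator (I m) := fun m =>
    𝒢.isPositiveOperator_integral_average hlam hproper (hφs m).isCompact (hβ1 m) (hβ m) (hβc m)
  obtain ⟨c, hc, hD⟩ := IsPositiveOperator.exists_weights hI hφ hφs hdom
  refine A.exists_isFullSystem_of_isPositiveOperator (IsPositiveOperator.tsum hI hc hD)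
    (fun f u hf hfs hf0 => ?_) (fun f z hf hfs hf0 hfz => ?_)
    fun g f f' hf hfs hf' hfs' hff' => ?_
  · have hz : ∀ m, I m f u = 0 := fun m => by
      refine integral_eq_zero_of_ae ?_
      filter_upwards [hlam.2.ae_moment_eq (A := 𝒢.leftMul) u] with k hk
      exact A.average_eq_zero (hβ m) fun z hz => hf0 z (hz.trans hk)
    simp [hz]
  · -- At the unit of `z`, which lies in the support of `lam`, the average of `f` is `∫ f dβ`.
    obtain ⟨m, hm⟩ := hcov z
    refine IsPositiveOperator.tsum_pos hI hc hD hf hfs hf0 (m := m) ?_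
    have hac := A.continuous_average (hφs m).isCompact (hβ1 m) (hβ m) (hβc m) hf hfs
    refine integral_pos_of_mem_support hac (hac.integrable_of_hasCompactSupport
      (A.hasCompactSupport_average hproper (hφs m).isCompact (hβ m) hfs))
      (A.average_nonneg hf0) (y := 𝒢.one (A.moment z)) ?_ ?_
    · rw [hlam.1.support_eq]
      exact 𝒢.r_one _
    · rw [A.average_one (hβ m)]
      exact hβpos m f z hf hfs hf0 hfz hm
  · refine tsum_congr fun m => congrArg (c m * ·) ?_
    exact hlam.2.integral_eq (A := 𝒢.leftMul) g
      (A.continuous_average (hφs m).isCompact (hβ1 m) (hβ m) (hβc m) hf hfs)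
      fun k hk => (A.average_mul (hβ m) (Eq.symm hk) hff').symm
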